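/- **Theorem 1.1.** Let $p$ be an odd prime and let $a$ be a positive integer. Let $h$ be a $p$-adic integer with $h\not\equiv 0\pmod p$, and suppose that $2h\not\equiv 1\pmod p$ or $p^a>3$. Then, in the ring $\mathbb{Z}_p$ of $p$-adic integers, $$\sum_{k=0}^{p^a-1}\binom{hp^a-1}{k}\binom{2k}{k}\left(-\frac h2\right)^k\equiv\left(\frac{1-2h}{p^a}\right)\left(1+h\left(\left(4-\frac 2h\right)^{p-1}-1\right)\right)\pmod{p^2},$$ where $\binom{x}{k}=x(x-1)\cdots(x-k+1)/k!$ for $x\in\mathbb{Z}_p$, and $\left(\frac{x}{p^a}\right)$ for $x\in\mathbb{Z}_p$ denotes the Jacobi symbol $\left(\frac{n}{p^a}\right)$ of any integer $n\equiv x\pmod{p^a}$. -/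

import Mathlib

/-- The Jacobi symbol `(x / p ^ a)` of a `p`-adic integer `x` over the power `p ^ a`: the usual
Jacobi symbol of the residue of `x` modulo `p ^ a`. The usual Jacobi symbol over `p ^ a` depends
only on the class of its numerator modulo `p ^ a`. -/
noncomputable def padicJacobiSym (p : ℕ) [Fact p.Prime] (x : ℤ_[p]) (a : ℕ) : ℤ :=
  jacobiSym ((PadicInt.toZModPow a x).val : ℤ) (p ^ a)

/-- On integers, `padicJacobiSym` is the usual Jacobi symbol. -/
theorem padicJacobiSym_intCast (p : ℕ) [Fact p.Prime] (n : ℤ) (a : ℕ) :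
    padicJacobiSym p (n : ℤ_[p]) a = jacobiSym n (p ^ a) := by
  have : NeZero (p ^ a) := ⟨pow_ne_zero _ (Fact.out : p.Prime).ne_zero⟩
  rw [padicJacobiSym, map_intCast, ZMod.val_intCast, ← jacobiSym.mod_left]

/-! Write n = p^a and h = 2z. Modulo p², (-1)^k C(hn-1, k) is affine in h (`dvd_ringChoose_sub`), so
the sum becomes (1-2z)A + 2zT with A = ∑ C(2k,k) z^k and T = ∑ C(n-1,k) C(2k,k) (-z)^k. If z = xy
with x + y = 1, then (x-y)² = 1-4z, and A(x-y) and T(x-y) are, modulo p², polynomials in x^n, y^n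
and (x-y)^n. Their combination depends only on z^n and (x-y)^n (`sq_dvd_sum_mul_sub`). Taking x - y
= δ, a formal square root of d = 1-4z, and cancelling δ gives twice the sum as d^((n-1)/2) (3 - 4z^n
- d^n). Euler's criterion and Fermat quotients of z and d turn this into the right-hand side,
because 4 - 2/h = -d/z. -/

/-! ### Exact identities for x + y = 1 -/

/-- Pascal's rule for truncated binomial expansions. -/
theorem sum_range_choose_succ {R : Type*} [CommRing R] (x y : R) {N r : ℕ} (hr : r ≤ N) :
    ∑ k ∈ Finset.range (r + 1), ((N + 1).choose k : R) * (x ^ (N + 1 - k) * y ^ k)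
      = (x + y) * ∑ k ∈ Finset.range r, (N.choose k : R) * (x ^ (N - k) * y ^ k)
        + (N.choose r : R) * (x ^ (N + 1 - r) * y ^ r) := by
  induction r with
  | zero => simp
  | succ r ih =>
    rw [Finset.sum_range_succ, ih (by lia), Finset.sum_range_succ, Nat.choose_succ_succ]
    obtain ⟨m, rfl⟩ := Nat.exists_eq_add_of_le hr
    rw [show r + 1 + m + 1 - r = m + 2 by lia, show r + 1 + m + 1 - (r + 1) = m + 1 by lia,
      show r + 1 + m - r = m + 1 by lia]
    push_cast
    ring

theorem sum_range_choose_two_mul_succ {R : Type*} [CommRing R] {x y : R} (hxy : x + y = 1)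
    (n : ℕ) :
    ∑ k ∈ Finset.range (n + 1),
        ((2 * (n + 1)).choose k : R) * (x ^ (2 * (n + 1) - k) * y ^ k)
      = ∑ k ∈ Finset.range n, ((2 * n).choose k : R) * (x ^ (2 * n - k) * y ^ k)
        + ((2 * n).choose n : R) * (x * y) ^ n * x
        - ((2 * n + 1).choose n : R) * (x * y) ^ (n + 1) := by
  have h1 := sum_range_choose_succ x y (N := 2 * n) (r := n) (by lia)
  have h2 := sum_range_choose_succ x y (N := 2 * n + 1) (r := n) (by lia)
  rw [Finset.sum_range_succ] at h1
  rw [show 2 * (n + 1) = 2 * n + 1 + 1 by ring, h2]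
  rw [show 2 * n + 1 - n = n + 1 by lia] at h1
  rw [show 2 * n + 1 + 1 - n = n + 2 by lia]
  rw [hxy, one_mul] at h1 ⊢
  have hy : y = 1 - x := by linear_combination hxy
  have h3 : x ^ (n + 2) = x ^ (n + 1) * (1 - y) := by rw [hy]; ring
  rw [h3]
  linear_combination h1

/-- Telescoping: from n to n + 1 the truncated expansion of (x+y)^(2n) gains C(2n,n)(xy)^n x plus a
term symmetric in x and y, which the difference kills. -/
theorem sum_centralBinom_mul_sub {R : Type*} [CommRing R] {x y : R} (hxy : x + y = 1) (n : ℕ) :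
    (∑ k ∈ Finset.range n, ((2 * k).choose k : R) * (x * y) ^ k) * (x - y)
      = ∑ k ∈ Finset.range n, ((2 * n).choose k : R) * (x ^ (2 * n - k) * y ^ k)
        - ∑ k ∈ Finset.range n, ((2 * n).choose k : R) * (y ^ (2 * n - k) * x ^ k) := by
  induction n with
  | zero => simp
  | succ n ih =>
    rw [sum_range_choose_two_mul_succ hxy, sum_range_choose_two_mul_succ ((add_comm y x).trans hxy),
      Finset.sum_range_succ, mul_comm y x]
    linear_combination ih

/-- The central coefficient of `(t - xy(1 + t)²) ^ N`, for `x + y = 1`, in two ways. -/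
theorem sum_choose_mul_centralBinom {R : Type*} [CommRing R] {x y : R} (hxy : x + y = 1) (N : ℕ) :
    ∑ k ∈ Finset.range (N + 1), (N.choose k : R) * ((2 * k).choose k : R) * (-(x * y)) ^ k
      = ∑ k ∈ Finset.range (N + 1), (N.choose k : R) ^ 2 * ((x ^ 2) ^ k * (y ^ 2) ^ (N - k)) := by
  open Polynomial in
  -- The quadratic splits because x² + y² = 1 - 2xy.
  have key : (X + C (-(x * y)) * (1 + X) ^ 2 : R[X]) = (C x * X + C (-y)) * (C (-y) * X + C x) := by
    have hC : C x + C y = (1 : R[X]) := by rw [← C_add, hxy, C_1]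
    simp only [C_neg, C_mul]
    linear_combination (X : R[X]) * (-(C x + C y) - 1) * hC
  have hl : ((X + C (-(x * y)) * (1 + X) ^ 2 : R[X]) ^ N).coeff N
      = ∑ k ∈ Finset.range (N + 1), (N.choose k : R) * ((2 * k).choose k : R)
          * (-(x * y)) ^ k := by
    rw [add_comm, add_pow, finsetSum_coeff]
    refine Finset.sum_congr rfl fun k hk => ?_
    have hk : k ≤ N := by simpa [Nat.lt_succ_iff] using hk
    rw [mul_pow, ← C_pow, ← pow_mul]
    have : (C ((-(x * y)) ^ k) * (1 + X) ^ (2 * k) * X ^ (N - k) * (N.choose k : R[X]) : R[X])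
      = C ((-(x * y)) ^ k * (N.choose k : R)) * ((1 + X) ^ (2 * k) * X ^ (N - k)) := by
      rw [C_mul, C_eq_natCast]; ring
    rw [this, coeff_C_mul, coeff_mul_X_pow', if_pos (by lia), show N - (N - k) = k by lia,
      coeff_one_add_X_pow]
    ring
  have hc (u v : R) (i : ℕ) (hi : i ≤ N) :
      ((C u * X + C v : R[X]) ^ N).coeff i = (N.choose i : R) * (u ^ i * v ^ (N - i)) := by
    rw [add_pow, finsetSum_coeff, Finset.sum_eq_single i]
    · have : ((C u * X) ^ i * C v ^ (N - i) * (N.choose i : R[X]) : R[X])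
          = C (u ^ i * v ^ (N - i) * (N.choose i : R)) * X ^ i := by
        simp only [C_mul, C_pow, C_eq_natCast]; ring
      rw [this, coeff_C_mul, coeff_X_pow_self]
      ring
    · intro j _ hj
      have : ((C u * X) ^ j * C v ^ (N - j) * (N.choose j : R[X]) : R[X])
          = C (u ^ j * v ^ (N - j) * (N.choose j : R)) * X ^ j := by
        simp only [C_mul, C_pow, C_eq_natCast]; ring
      rw [this, coeff_C_mul, coeff_X_pow, if_neg (Ne.symm hj), mul_zero]
    · intro h
      exact absurd (Finset.mem_range.2 (by lia)) h
  rw [← hl, key, mul_pow, coeff_mul, Finset.Nat.sum_antidiagonal_eq_sum_range_succ_mk]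
  refine Finset.sum_congr rfl fun k hk => ?_
  have hk : k ≤ N := by simpa [Nat.lt_succ_iff] using hk
  rw [hc _ _ _ hk, hc _ _ _ (Nat.sub_le _ _), Nat.choose_symm hk, Nat.sub_sub_self hk]
  have : (y ^ 2) ^ (N - k) = (-y) ^ (N - k) * (-y) ^ (N - k) := by
    rw [← mul_pow]; congr 1; ring
  rw [this]
  ring

/-! ### Binomial coefficients modulo p and p² -/

theorem Nat.Prime.sq_dvd_choose_two_mul_pow_sub {p : ℕ} (hp : p.Prime) (a : ℕ) {k : ℕ}
    (hk0 : 0 < k) (hk : k < p ^ a) :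
    (p : ℤ) ^ 2 ∣ ((2 * p ^ a).choose k : ℤ) - 2 * ((p ^ a).choose k : ℤ) := by
  obtain ⟨m, rfl⟩ := Nat.exists_eq_add_of_le' hk0
  -- Vandermonde: the two end terms give 2 C(p^a, k); each inner term has two factors divisible by
  -- p.
  rw [two_mul, Nat.add_choose_eq, Finset.Nat.sum_antidiagonal_eq_sum_range_succ_mk,
    Finset.sum_range_succ, Finset.sum_range_succ']
  simp only [Nat.choose_zero_right, Nat.sub_zero, Nat.sub_self]
  push_cast
  rw [show ∀ s c : ℤ, s + 1 * c + c * 1 - 2 * c = s by intros; ring]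
  refine Finset.dvd_sum fun i hi => ?_
  have hi := Finset.mem_range.1 hi
  rw [sq]
  exact mul_dvd_mul (Int.natCast_dvd_natCast.2 (hp.dvd_choose_pow (by lia) (by lia)))
    (Int.natCast_dvd_natCast.2 (hp.dvd_choose_pow (by lia) (by lia)))

theorem Nat.Prime.dvd_neg_one_pow_mul_choose_sub_one {p : ℕ} (hp : p.Prime) (a : ℕ) {k : ℕ}
    (hk : k < p ^ a) :
    (p : ℤ) ∣ (-1) ^ k * ((p ^ a - 1).choose k : ℤ) - 1 := by
  induction k with
  | zero => simp
  | succ k ih =>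
    have h1 : (p ^ a).choose (k + 1) = (p ^ a - 1).choose k + (p ^ a - 1).choose (k + 1) := by
      conv_lhs => rw [show p ^ a = p ^ a - 1 + 1 by lia]
      rw [Nat.choose_succ_succ]
    have h2 : (p : ℤ) ∣ ((p ^ a).choose (k + 1) : ℤ) :=
      Int.natCast_dvd_natCast.2 (hp.dvd_choose_pow (by lia) (by lia))
    rw [h1] at h2
    push_cast at h2
    have h3 := _root_.dvd_sub (ih (by lia)) (dvd_mul_of_dvd_right h2 ((-1 : ℤ) ^ k))
    rw [show (-1 : ℤ) ^ (k + 1) * ((p ^ a - 1).choose (k + 1) : ℤ) - 1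
      = (-1 : ℤ) ^ k * ((p ^ a - 1).choose k : ℤ) - 1 - (-1 : ℤ) ^ k
        * (((p ^ a - 1).choose k : ℤ) + ((p ^ a - 1).choose (k + 1) : ℤ)) by ring]
    exact h3

theorem Nat.Prime.sq_dvd_sq_choose_sub {p : ℕ} (hp : p.Prime) (a : ℕ) {k : ℕ}
    (hk : k < p ^ a) :
    (p : ℤ) ^ 2 ∣ ((p ^ a - 1).choose k : ℤ) ^ 2
      - (2 * ((-1) ^ k * ((p ^ a - 1).choose k : ℤ)) - 1) := by
  have h := _root_.pow_dvd_pow_of_dvd (hp.dvd_neg_one_pow_mul_choose_sub_one a hk) 2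
  have h2 : ((-1 : ℤ) ^ k) ^ 2 = 1 := by rw [← pow_mul, mul_comm, pow_mul]; simp
  have h3 : ((p ^ a - 1).choose k : ℤ) ^ 2 - (2 * ((-1) ^ k * ((p ^ a - 1).choose k : ℤ)) - 1)
      = ((-1) ^ k * ((p ^ a - 1).choose k : ℤ) - 1) ^ 2 := by
    linear_combination (-((p ^ a - 1).choose k : ℤ) ^ 2) * h2
  rw [h3]
  exact h

theorem intCast_pow_dvd_intCast {R : Type*} [CommRing R] {p m : ℤ} {e : ℕ} (h : p ^ e ∣ m) :
    (p : R) ^ e ∣ (m : R) := by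
  simpa using map_dvd (Int.castRingHom R) h

/-! ### The two sums modulo p² over any commutative ring -/

theorem Nat.Prime.sq_dvd_sum_choose_two_mul_sub {R : Type*} [CommRing R] {p : ℕ} (hp : p.Prime)
    (a : ℕ) {x y : R} (hxy : x + y = 1) :
    (p : R) ^ 2 ∣ ∑ k ∈ Finset.range (p ^ a),
        ((2 * p ^ a).choose k : R) * (x ^ (2 * p ^ a - k) * y ^ k)
      - (2 * x ^ p ^ a - 2 * (x * y) ^ p ^ a - x ^ (2 * p ^ a)) := by
  have hpos : 0 < p ^ a := pow_pos hp.pos a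
  have h1 : 2 * x ^ p ^ a - 2 * (x * y) ^ p ^ a
      = ∑ k ∈ Finset.range (p ^ a),
        (2 * ((p ^ a).choose k : R)) * (x ^ (2 * p ^ a - k) * y ^ k) := by
    have h2 := add_pow y x (p ^ a)
    rw [add_comm y x, hxy, one_pow, Finset.sum_range_succ, Nat.sub_self, Nat.choose_self] at h2
    have h3 : ∑ k ∈ Finset.range (p ^ a),
        (2 * ((p ^ a).choose k : R)) * (x ^ (2 * p ^ a - k) * y ^ k)
        = 2 * x ^ p ^ a * ∑ k ∈ Finset.range (p ^ a),
          y ^ k * x ^ (p ^ a - k) * ((p ^ a).choose k : R) := by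
      rw [Finset.mul_sum]
      refine Finset.sum_congr rfl fun k hk => ?_
      have hk := Finset.mem_range.1 hk
      rw [show 2 * p ^ a - k = p ^ a + (p ^ a - k) by lia, pow_add]
      ring
    rw [h3, mul_pow]
    push_cast at h2
    linear_combination (2 * x ^ p ^ a) * h2
  rw [h1, show ∀ s t w : R, s - (t - w) = (s - t) + w by intros; ring, ← Finset.sum_sub_distrib]
  obtain ⟨m, hm⟩ := Nat.exists_eq_add_of_le' hpos
  -- At k = 0 the coefficient is 1, not 2, which accounts for the term x^(2p^a).
  rw [hm, Finset.sum_range_succ', ← hm]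
  simp only [Nat.choose_zero_right, Nat.sub_zero, pow_zero]
  push_cast
  rw [show ∀ s w : R, s + (1 * (w * 1) - 2 * 1 * (w * 1)) + w = s by intros; ring]
  refine Finset.dvd_sum fun k hk => ?_
  have hk := Finset.mem_range.1 hk
  rw [← sub_mul]
  refine Dvd.dvd.mul_right ?_ _
  simpa using intCast_pow_dvd_intCast (R := R)
    (hp.sq_dvd_choose_two_mul_pow_sub a (Nat.succ_pos k) (by lia))

theorem Nat.Prime.sq_dvd_sum_centralBinom_mul_sub {R : Type*} [CommRing R] {p : ℕ} (hp : p.Prime)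
    (a : ℕ) {x y : R} (hxy : x + y = 1) :
    (p : R) ^ 2 ∣ (∑ k ∈ Finset.range (p ^ a), ((2 * k).choose k : R) * (x * y) ^ k) * (x - y)
      - (2 * (x ^ p ^ a - y ^ p ^ a) - (x ^ p ^ a - y ^ p ^ a) * (x ^ p ^ a + y ^ p ^ a)) := by
  rw [sum_centralBinom_mul_sub hxy]
  have h := _root_.dvd_sub (hp.sq_dvd_sum_choose_two_mul_sub a hxy)
    (hp.sq_dvd_sum_choose_two_mul_sub a ((add_comm y x).trans hxy))
  refine h.trans (dvd_of_eq ?_)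
  rw [mul_comm y x]
  ring

/-- Replacing C(N,k)² by 2(-1)^k C(N,k) - 1 splits the sum of squares into a binomial expansion and
a geometric sum in x², y². -/
theorem Nat.Prime.sq_dvd_sum_choose_mul_centralBinom_mul_sub {R : Type*} [CommRing R] {p : ℕ}
    (hp : p.Prime) (hodd : Odd p) (a : ℕ) {x y : R} (hxy : x + y = 1) :
    (p : R) ^ 2 ∣ (∑ k ∈ Finset.range (p ^ a),
        ((p ^ a - 1).choose k : R) * ((2 * k).choose k : R) * (-(x * y)) ^ k) * (x - y)
      - (2 * (x - y) ^ p ^ a - (x ^ p ^ a - y ^ p ^ a) * (x ^ p ^ a + y ^ p ^ a)) := by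
  obtain ⟨N, hN⟩ : ∃ N, p ^ a = N + 1 := Nat.exists_eq_add_of_le' (pow_pos hp.pos a)
  have hN' : p ^ a - 1 = N := by lia
  have hev : Even N := by
    have := hodd.pow (n := a)
    rw [hN] at this
    grind
  have hd : x - y = x ^ 2 - y ^ 2 := by linear_combination (-(x - y)) * hxy
  have h1 : (y ^ 2 - x ^ 2) ^ N
      = ∑ k ∈ Finset.range (N + 1),
        ((-1) ^ k * (N.choose k : R)) * ((x ^ 2) ^ k * (y ^ 2) ^ (N - k)) := by
    rw [sub_eq_neg_add, add_pow]
    refine Finset.sum_congr rfl fun k _ => ?_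
    rw [neg_pow (x ^ 2)]
    ring
  have h2 := geom_sum₂_mul (x ^ 2) (y ^ 2) (N + 1)
  rw [Nat.add_sub_cancel] at h2
  have h3 : (x - y) ^ (N + 1) = (y ^ 2 - x ^ 2) ^ N * (x - y) := by
    rw [pow_succ, ← hev.neg_pow (y ^ 2 - x ^ 2), neg_sub, ← hd]
  have h4 : (x ^ (N + 1) - y ^ (N + 1)) * (x ^ (N + 1) + y ^ (N + 1))
      = (∑ k ∈ Finset.range (N + 1), (x ^ 2) ^ k * (y ^ 2) ^ (N - k)) * (x - y) := by
    rw [hd, h2]; ring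
  rw [hN', hN, sum_choose_mul_centralBinom hxy, h4, h3, h1, ← mul_assoc, ← sub_mul, ← sub_mul,
    Finset.mul_sum, ← Finset.sum_sub_distrib, ← Finset.sum_sub_distrib]
  refine Dvd.dvd.mul_right (Finset.dvd_sum fun k hk => ?_) _
  have hk : k < p ^ a := hN ▸ Finset.mem_range.1 hk
  have h5 := intCast_pow_dvd_intCast (R := R) (hp.sq_dvd_sq_choose_sub a hk)
  rw [hN'] at h5
  push_cast at h5
  refine (h5.mul_right ((x ^ 2) ^ k * (y ^ 2) ^ (N - k))).trans (dvd_of_eq ?_)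
  ring

theorem Nat.Prime.sq_dvd_sum_mul_sub {R : Type*} [CommRing R] {p : ℕ} (hp : p.Prime)
    (hodd : Odd p) (a : ℕ) {x y z : R} (hxy : x + y = 1) (hz : x * y = z)
    (hzp : (p : R) ∣ z ^ p ^ a - z) :
    (p : R) ^ 2 ∣ 2 * (((1 - 2 * z)
          * ∑ k ∈ Finset.range (p ^ a), ((2 * k).choose k : R) * z ^ k
        + 2 * z * ∑ k ∈ Finset.range (p ^ a),
          ((p ^ a - 1).choose k : R) * ((2 * k).choose k : R) * (-z) ^ k) * (x - y))
      - (x - y) ^ p ^ a * (3 - 4 * z ^ p ^ a - ((x - y) ^ p ^ a) ^ 2) := by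
  obtain ⟨α, hA⟩ := hp.sq_dvd_sum_centralBinom_mul_sub a hxy
  obtain ⟨β, hT⟩ := hp.sq_dvd_sum_choose_mul_centralBinom_mul_sub hodd a hxy
  have hfrob (s t : R) : ∃ r, (s + t) ^ p ^ a = s ^ p ^ a + t ^ p ^ a + p * r := by
    obtain ⟨r, hr⟩ := exists_add_pow_prime_pow_eq hp s t a
    exact ⟨s * t * r, by rw [hr]; ring⟩
  obtain ⟨u, hu⟩ := hfrob x y
  obtain ⟨v, hv⟩ := hfrob (x - y) y
  obtain ⟨s, hs⟩ := hzp
  have hXY : x ^ p ^ a * y ^ p ^ a = z ^ p ^ a := by rw [← mul_pow, hz]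
  rw [hz] at hA hT
  rw [hxy, one_pow] at hu
  rw [sub_add_cancel] at hv
  generalize x ^ p ^ a = X at *
  generalize y ^ p ^ a = Y at *
  generalize (x - y) ^ p ^ a = D at *
  generalize z ^ p ^ a = Z at *
  generalize ∑ k ∈ Finset.range (p ^ a), ((2 * k).choose k : R) * z ^ k = A at *
  generalize ∑ k ∈ Finset.range (p ^ a),
    ((p ^ a - 1).choose k : R) * ((2 * k).choose k : R) * (-z) ^ k = T at *
  obtain ⟨P, hP⟩ : ∃ P, P = X + Y := ⟨_, rfl⟩
  obtain ⟨Q, hQ⟩ : ∃ Q, Q = X - Y := ⟨_, rfl⟩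
  have hPQ : P ^ 2 - Q ^ 2 = 4 * Z := by rw [hP, hQ, ← hXY]; ring
  rw [← hP, ← hQ] at hA
  rw [← hP, ← hQ] at hT
  have hP' : P = 1 - p * u := by linear_combination hP - hu
  have hQ' : Q = D + p * v := by linear_combination hQ + hv
  have hZ : Z = z + p * s := by linear_combination hs
  subst hP' hQ' hZ
  -- As P ≡ 1 mod p, 2P ≡ 1 + P² = 1 + Q² + 4Z mod p². After Q = D + pv the terms linear in v
  -- cancel, since D² ≡ 1 - 4z mod p.
  refine ⟨6 * u * v + u ^ 2 * D + 3 * v ^ 2 * D - 2 * p * v * u ^ 2 + 2 * p * v ^ 3 + 8 * v * s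
    + 2 * ((1 - 2 * z) * α + 2 * z * β), ?_⟩
  linear_combination 2 * (1 - 2 * z) * hA + 4 * z * hT + (2 * p * v - D) * hPQ

/-! ### Congruences in the p-adic integers -/

namespace PadicInt

variable {p : ℕ} [hp : Fact p.Prime]

theorem dvd_iff_toZMod_eq_zero {x : ℤ_[p]} : (p : ℤ_[p]) ∣ x ↔ toZMod x = 0 := by
  rw [← RingHom.mem_ker, ker_toZMod, maximalIdeal_eq_span_p, Ideal.mem_span_singleton]

theorem isUnit_of_not_dvd {x : ℤ_[p]} (hx : ¬ (p : ℤ_[p]) ∣ x) : IsUnit x := by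
  by_contra h
  exact hx ((norm_lt_one_iff_dvd x).1 (not_isUnit_iff.1 h))

theorem isUnit_two (hodd : Odd p) : IsUnit (2 : ℤ_[p]) := by
  refine isUnit_of_not_dvd fun h => ?_
  have h2 : (p : ℤ_[p]) ^ 1 ∣ ((2 : ℤ) : ℤ_[p]) := by simpa using h
  rw [pow_p_dvd_int_iff] at h2
  have := Int.le_of_dvd (by norm_num) h2
  have := hp.out.two_le
  grind

theorem dvd_pow_prime_pow_sub_self (x : ℤ_[p]) (a : ℕ) : (p : ℤ_[p]) ∣ x ^ p ^ a - x := by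
  rw [dvd_iff_toZMod_eq_zero, map_sub, map_pow, sub_eq_zero, ZMod.pow_card_pow]

theorem sq_dvd_pow_prime_pow_sub (x : ℤ_[p]) {a : ℕ} (ha : 0 < a) :
    (p : ℤ_[p]) ^ 2 ∣ x ^ p ^ a - x ^ p := by
  obtain ⟨b, rfl⟩ := Nat.exists_eq_add_of_le' ha
  simpa [pow_succ, pow_mul] using dvd_sub_pow_of_dvd_sub (dvd_pow_prime_pow_sub_self x b) 1

theorem dvd_pow_prime_sub_one_sub_one {x : ℤ_[p]} (hx : ¬ (p : ℤ_[p]) ∣ x) :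
    (p : ℤ_[p]) ∣ x ^ (p - 1) - 1 := by
  rw [dvd_iff_toZMod_eq_zero] at hx ⊢
  rw [map_sub, map_pow, ZMod.pow_card_sub_one_eq_one hx, map_one, sub_self]

theorem dvd_ringChoose_sub (a : ℕ) (h : ℤ_[p]) {k : ℕ} (hk : k < p ^ a) :
    (p : ℤ_[p]) ^ 2 ∣ (-1) ^ k * Ring.choose (h * (p : ℤ_[p]) ^ a - 1) k
      - (1 + h * ((-1) ^ k * ((p ^ a - 1).choose k : ℤ_[p]) - 1)) := by
  induction k with
  | zero => simp
  | succ k ih =>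
    obtain ⟨e, he⟩ := ih (by lia)
    obtain ⟨s, hs⟩ := intCast_pow_dvd_intCast (R := ℤ_[p]) (e := 1)
      (by simpa using hp.out.dvd_neg_one_pow_mul_choose_sub_one a (k := k) (by lia))
    obtain ⟨t, ht⟩ : (p : ℤ_[p]) ∣ ((p ^ a).choose (k + 1) : ℤ_[p]) :=
      Nat.cast_dvd_cast (hp.out.dvd_choose_pow (by lia) (by lia))
    have hr1 := Ring.choose_succ_succ (h * (p : ℤ_[p]) ^ a - 1) k
    rw [sub_add_cancel] at hr1
    have hr2 := Ring.choose_smul_choose (h * (p : ℤ_[p]) ^ a) (n := k + 1) (k := 1) (by lia)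
    rw [Ring.choose_one_right, Nat.choose_one_right, Nat.add_sub_cancel, nsmul_eq_mul,
      Nat.cast_one] at hr2
    have hn1 : (p ^ a).choose (k + 1) = (p ^ a - 1).choose k + (p ^ a - 1).choose (k + 1) := by
      conv_lhs => rw [show p ^ a = p ^ a - 1 + 1 by lia]
      rw [Nat.choose_succ_succ]
    have hn2 : p ^ a * (p ^ a - 1).choose k = (p ^ a).choose (k + 1) * (k + 1) := by
      have := Nat.add_one_mul_choose_eq (p ^ a - 1) k
      rwa [show p ^ a - 1 + 1 = p ^ a by lia] at this
    have hn1 := congrArg (Nat.cast : ℕ → ℤ_[p]) hn1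
    have hn2 := congrArg (Nat.cast : ℕ → ℤ_[p]) hn2
    push_cast at hn1 hn2 hs hr2
    have hk0 : ((k : ℤ_[p]) + 1) ≠ 0 := by exact_mod_cast Nat.succ_ne_zero k
    generalize Ring.choose (h * (p : ℤ_[p]) ^ a - 1) k = c at *
    generalize Ring.choose (h * (p : ℤ_[p]) ^ a - 1) (k + 1) = c' at *
    generalize Ring.choose (h * (p : ℤ_[p]) ^ a) (k + 1) = g at *
    generalize ((p ^ a - 1).choose k : ℤ_[p]) = b at *
    generalize ((p ^ a - 1).choose (k + 1) : ℤ_[p]) = b' at *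
    generalize ((p ^ a).choose (k + 1) : ℤ_[p]) = f at *
    -- Absorption for both C(hp^a, k+1) and C(p^a, k+1). As ±b ≡ 1 mod p, it yields p ∣ g and then g
    -- ≡ h f mod p², so Pascal's rule closes the induction.
    have key : g * b = h * c * f := by
      refine mul_left_cancel₀ hk0 ?_
      linear_combination b * hr2 + h * c * hn2
    have hee : ((-1 : ℤ_[p]) ^ k) ^ 2 = 1 := by rw [← pow_mul, mul_comm, pow_mul]; simp
    rw [pow_succ (-1 : ℤ_[p]) k]
    generalize (-1 : ℤ_[p]) ^ k = E at *
    rw [pow_one] at hs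
    obtain ⟨g', hg'⟩ : (p : ℤ_[p]) ∣ g := by
      refine ⟨E * h * c * t - s * g, ?_⟩
      linear_combination E * key - g * hs + E * h * c * ht
    refine ⟨e - E * (h * t * (h * s + p * e) - s * g'), ?_⟩
    linear_combination he + E * hr1 - h * E * hn1 - E * (E * key - g * hs + h * f * he
      + h ^ 2 * f * hs + (h * p ^ 2 * e + h ^ 2 * p * s) * ht - p * s * hg')

theorem sq_dvd_sum_ringChoose_sub (a : ℕ) (z : ℤ_[p]) :
    (p : ℤ_[p]) ^ 2 ∣ ∑ k ∈ Finset.range (p ^ a),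
        Ring.choose (2 * z * (p : ℤ_[p]) ^ a - 1) k * ((2 * k).choose k : ℤ_[p]) * (-z) ^ k
      - ((1 - 2 * z) * ∑ k ∈ Finset.range (p ^ a), ((2 * k).choose k : ℤ_[p]) * z ^ k
        + 2 * z * ∑ k ∈ Finset.range (p ^ a),
          ((p ^ a - 1).choose k : ℤ_[p]) * ((2 * k).choose k : ℤ_[p]) * (-z) ^ k) := by
  rw [Finset.mul_sum, Finset.mul_sum, ← Finset.sum_add_distrib, ← Finset.sum_sub_distrib]
  refine Finset.dvd_sum fun k hk => ?_
  refine ((dvd_ringChoose_sub a (2 * z) (Finset.mem_range.1 hk)).mul_right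
    (((2 * k).choose k : ℤ_[p]) * z ^ k)).trans (dvd_of_eq ?_)
  rw [neg_pow z]
  ring

/-- A root-free evaluation, obtained in the quadratic algebra generated by a square root of
`1 - 4 * z`. -/
theorem sq_dvd_sum_centralBinom_add_sub (hodd : Odd p) (a : ℕ) (z : ℤ_[p]) :
    (p : ℤ_[p]) ^ 2 ∣ 2 * ((1 - 2 * z)
          * ∑ k ∈ Finset.range (p ^ a), ((2 * k).choose k : ℤ_[p]) * z ^ k
        + 2 * z * ∑ k ∈ Finset.range (p ^ a),
          ((p ^ a - 1).choose k : ℤ_[p]) * ((2 * k).choose k : ℤ_[p]) * (-z) ^ k)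
      - (1 - 4 * z) ^ (p ^ a / 2) * (3 - 4 * z ^ p ^ a - (1 - 4 * z) ^ p ^ a) := by
  obtain ⟨i, hi⟩ := (isUnit_two hodd).exists_right_inv
  let S := QuadraticAlgebra ℤ_[p] (1 - 4 * z) 0
  let f : ℤ_[p] →+* S := algebraMap ℤ_[p] S
  let δ : S := QuadraticAlgebra.omega
  have hδ : δ ^ 2 = f (1 - 4 * z) := by
    rw [sq]
    exact QuadraticAlgebra.omega_mul_omega_eq_add.trans (by simp [f, Algebra.algebraMap_eq_smul_one])
  have hfi : 2 * f i = 1 := by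
    have := congrArg f hi
    rwa [map_mul, map_one, map_ofNat] at this
  have hxy : f i * (1 + δ) + f i * (1 - δ) = 1 := by linear_combination hfi
  have hsub : f i * (1 + δ) - f i * (1 - δ) = δ := by linear_combination δ * hfi
  have hz : f i * (1 + δ) * (f i * (1 - δ)) = f z := by
    rw [map_sub, map_mul, map_one, map_ofNat] at hδ
    linear_combination -(f i) ^ 2 * hδ + (2 * f i + 1) * f z * hfi
  have hzp : (p : S) ∣ f z ^ p ^ a - f z := by
    simpa using map_dvd f (dvd_pow_prime_pow_sub_self z a)
  obtain ⟨q, hq⟩ := hp.out.sq_dvd_sum_mul_sub hodd a hxy hz hzp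
  rw [hsub, ← pow_mul, mul_comm (p ^ a) 2, pow_mul, hδ] at hq
  obtain ⟨M, hM⟩ : ∃ M, p ^ a = 2 * M + 1 := hodd.pow (n := a)
  have hδn : δ ^ p ^ a = f ((1 - 4 * z) ^ (p ^ a / 2)) * δ := by
    rw [show p ^ a / 2 = M by lia, map_pow, ← hδ, ← pow_mul, ← pow_succ, hM]
  rw [hδn] at hq
  have him (r : ℤ_[p]) (s : S) : (f r * s).im = r * s.im := by
    rw [show f r * s = r • s from (Algebra.smul_def r s).symm]
    exact QuadraticAlgebra.im_smul r s
  have hre : f (2 * ((1 - 2 * z)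
          * ∑ k ∈ Finset.range (p ^ a), ((2 * k).choose k : ℤ_[p]) * z ^ k
        + 2 * z * ∑ k ∈ Finset.range (p ^ a),
          ((p ^ a - 1).choose k : ℤ_[p]) * ((2 * k).choose k : ℤ_[p]) * (-z) ^ k)
      - (1 - 4 * z) ^ (p ^ a / 2) * (3 - 4 * z ^ p ^ a - (1 - 4 * z) ^ p ^ a)) * δ
      = f ((p : ℤ_[p]) ^ 2) * q := by
    rw [map_pow f (p : ℤ_[p]), map_natCast, ← hq]
    simp only [map_sub, map_mul, map_add, map_sum, map_pow, map_neg, map_natCast, map_ofNat,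
      map_one]
    ring
  -- `S` is free on 1 and δ even when 1 - 4z is a square or zero, so reading off the δ-coordinate
  -- cancels δ.
  have := congrArg QuadraticAlgebra.im hre
  rw [him, him, QuadraticAlgebra.omega_im, mul_one] at this
  exact ⟨_, this⟩

theorem toZMod_padicJacobiSym (hodd : Odd p) {a : ℕ} (ha : 0 < a) (x : ℤ_[p]) :
    toZMod ((padicJacobiSym p x a : ℤ) : ℤ_[p]) = toZMod (x ^ (p ^ a / 2)) := by
  obtain ⟨m, hm⟩ : ∃ m : ℤ, (p : ℤ_[p]) ^ a ∣ x - m := by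
    refine ⟨(toZModPow a x).val, ?_⟩
    have : NeZero (p ^ a) := ⟨pow_ne_zero _ hp.out.ne_zero⟩
    rw [← Ideal.mem_span_singleton, ← ker_toZModPow, RingHom.mem_ker]
    simp
  have h1 : padicJacobiSym p x a = jacobiSym m (p ^ a) := by
    rw [← padicJacobiSym_intCast, padicJacobiSym, padicJacobiSym]
    have : toZModPow a x = toZModPow a (m : ℤ_[p]) := by
      rw [← sub_eq_zero, ← map_sub, ← RingHom.mem_ker, ker_toZModPow, Ideal.mem_span_singleton]
      exact hm
    rw [this]
  have h2 : toZMod x = (m : ZMod p) := by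
    rw [← map_intCast toZMod, ← sub_eq_zero, ← map_sub, ← dvd_iff_toZMod_eq_zero]
    exact (dvd_pow_self _ ha.ne').trans hm
  rw [h1, map_intCast, map_pow, h2, jacobiSym.pow_right, ← jacobiSym.legendreSym.to_jacobiSym]
  push_cast
  rw [legendreSym.eq_pow, ← pow_mul]
  clear h1 h2 hm ha
  induction a with
  | zero => simp
  | succ a ih =>
    obtain ⟨M, hM⟩ : ∃ M, p ^ a = 2 * M + 1 := hodd.pow (n := a)
    obtain ⟨N, hN⟩ := hodd
    -- Raising to the power p is trivial on `ZMod p`, so each step contributes one more Legendre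
    -- factor.
    have h3 : p ^ (a + 1) / 2 = p ^ a / 2 * p + p / 2 := by
      rw [pow_succ, show p ^ a / 2 = M by lia, show p / 2 = N by lia, hM]
      have : (2 * M + 1) * p = 2 * (M * p + N) + 1 := by rw [add_mul, one_mul]; nlinarith
      lia
    rw [mul_add, mul_one, pow_add, ih, h3, pow_add, pow_mul _ _ p, ZMod.pow_card]

end PadicInt

/-! ### The theorem -/

open PadicInt in
theorem theorem1p1 (p : ℕ) [Fact p.Prime] (hp : Odd p) (a : ℕ) (ha : 0 < a)
    (h : ℤ_[p]) (hh : ¬ (p : ℤ_[p]) ∣ h)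
    (hcond : ¬ (p : ℤ_[p]) ∣ 2 * h - 1 ∨ 3 < p ^ a) :
    (∑ k ∈ Finset.range (p ^ a),
        Ring.choose (h * (p : ℤ_[p]) ^ a - 1) k * ((2 * k).choose k : ℤ_[p])
          * (-(h * Ring.inverse 2)) ^ k)
      ≡ (padicJacobiSym p (1 - 2 * h) a : ℤ_[p])
          * (1 + h * ((4 - 2 * Ring.inverse h) ^ (p - 1) - 1))
      [SMOD Ideal.span {(p : ℤ_[p]) ^ 2}] := by
  have hprime : p.Prime := Fact.out
  have h2 := isUnit_two hp
  have hu := isUnit_of_not_dvd hh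
  obtain ⟨z, hz⟩ : ∃ z, z = h * Ring.inverse 2 := ⟨_, rfl⟩
  have hzh : h = 2 * z := by
    rw [hz, mul_left_comm, Ring.mul_inverse_cancel _ h2, mul_one]
  have hz0 : ¬ (p : ℤ_[p]) ∣ z := fun hd => hh (hzh ▸ hd.mul_left 2)
  have hinv := Ring.mul_inverse_cancel _ hu
  generalize Ring.inverse h = g at *
  rw [SModEq.sub_mem, Ideal.mem_span_singleton, ← hz]
  subst hzh
  have hd : (1 - 2 * (2 * z) : ℤ_[p]) = 1 - 4 * z := by ring
  rw [hd]
  have hcond' : (p : ℤ_[p]) ∣ 1 - 4 * z → 3 < p ^ a := by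
    intro h4
    refine hcond.resolve_left (fun h5 => h5 ?_)
    rw [← dvd_neg]
    convert h4 using 1
    ring
  have hST := dvd_add ((sq_dvd_sum_ringChoose_sub a z).mul_left 2)
    (sq_dvd_sum_centralBinom_add_sub hp a z)
  have hJ := toZMod_padicJacobiSym hp ha (1 - 4 * z)
  have htri : padicJacobiSym p (1 - 4 * z) a = 0 ∨ padicJacobiSym p (1 - 4 * z) a = 1
    ∨ padicJacobiSym p (1 - 4 * z) a = -1 := jacobiSym.trichotomy _ _
  rw [eq_comm, ← sub_eq_zero, ← map_sub, ← dvd_iff_toZMod_eq_zero] at hJ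
  obtain ⟨M, hM⟩ : ∃ M, p ^ a = 2 * M + 1 := hp.pow (n := a)
  rw [show p ^ a / 2 = M by lia] at hST hJ
  rw [← add_sub_assoc, ← mul_add, sub_add_cancel] at hST
  generalize ∑ k ∈ Finset.range (p ^ a), Ring.choose (2 * z * (p : ℤ_[p]) ^ a - 1) k
    * ((2 * k).choose k : ℤ_[p]) * (-z) ^ k = S at *
  have hp1 : ¬ (p : ℤ_[p]) ∣ 1 := fun h1 => prime_p.not_isUnit (isUnit_of_dvd_one h1)
  by_cases hpd : (p : ℤ_[p]) ∣ 1 - 4 * z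
  · have hM2 : 2 ≤ M := by have := hcond' hpd; lia
    have hJ0 : padicJacobiSym p (1 - 4 * z) a = 0 := by
      have h3 := (dvd_sub_right (hpd.trans (dvd_pow_self _ (by lia : M ≠ 0)))).1 hJ
      rcases htri with h0 | h0 | h0
      · exact h0
      · exact absurd (by simpa [h0] using h3) hp1
      · exact absurd (by simpa [h0] using h3) hp1
    have hw : (p : ℤ_[p]) ^ 2 ∣ (1 - 4 * z) ^ M :=
      (pow_dvd_pow_of_dvd hpd 2).trans (pow_dvd_pow _ hM2)
    rw [hJ0, Int.cast_zero, zero_mul, sub_zero]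
    exact h2.dvd_mul_left.1 ((dvd_sub_left (hw.mul_right _)).1 hST)
  · have hJsq : (padicJacobiSym p (1 - 4 * z) a : ℤ_[p]) ^ 2 = 1 := by
      rcases htri with h0 | h0 | h0
      · rw [h0, Int.cast_zero, sub_zero] at hJ
        exact absurd (prime_p.dvd_of_dvd_pow hJ) hpd
      · simp [h0]
      · simp [h0]
    generalize (padicJacobiSym p (1 - 4 * z) a : ℤ_[p]) = J at *
    obtain ⟨d, hdz⟩ : ∃ d, d = 1 - 4 * z := ⟨_, rfl⟩
    rw [← hdz] at hST hJ hpd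
    have hpow (x : ℤ_[p]) : x ^ p = x * x ^ (p - 1) := by
      rw [← pow_succ', Nat.sub_add_cancel hprime.one_le]
    obtain ⟨σ, hσ⟩ := hST
    obtain ⟨t, ht⟩ := hJ
    obtain ⟨γ, hγ⟩ := dvd_pow_prime_sub_one_sub_one hz0
    obtain ⟨φ, hφ⟩ := dvd_pow_prime_sub_one_sub_one hpd
    obtain ⟨e₂, he₂⟩ := sq_dvd_pow_prime_pow_sub z ha
    obtain ⟨e₃, he₃⟩ := sq_dvd_pow_prime_pow_sub d ha
    rw [hpow] at he₂ he₃
    obtain ⟨e₁, he₁⟩ : (p : ℤ_[p]) ^ 2 ∣ (d ^ M) ^ 2 - d ^ (p - 1) := by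
      refine (isUnit_of_not_dvd hpd).dvd_mul_left.1 ⟨e₃, ?_⟩
      rw [← he₃, hM]
      ring
    have hE : z ^ (p - 1) * (4 - 2 * g) ^ (p - 1) = d ^ (p - 1) := by
      have hev : Even (p - 1) := hp.tsub_odd odd_one
      rw [← mul_pow, ← hev.neg_pow d]
      congr 1
      linear_combination hdz - hinv
    generalize (4 - 2 * g) ^ (p - 1) = E at *
    generalize d ^ (p - 1) = dp at *
    generalize z ^ (p - 1) = zp at *
    generalize z ^ p ^ a = zn at *
    generalize d ^ p ^ a = dn at *
    generalize d ^ M = w at *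
    obtain rfl : zp = 1 + p * γ := by linear_combination hγ
    obtain rfl : dp = 1 + p * φ := by linear_combination hφ
    obtain rfl : zn = z * (1 + p * γ) + p ^ 2 * e₂ := by linear_combination he₂
    obtain rfl : dn = d * (1 + p * φ) + p ^ 2 * e₃ := by linear_combination he₃
    -- From w ≡ J mod p and J² = 1, (w - J)² ≡ 0 gives 2w ≡ J(w² + 1) mod p².
    have h2w : 2 * w = J * (2 + p * φ) + p ^ 2 * (J * e₁ - J * t ^ 2) := by
      linear_combination J * he₁ - J * (w - J + p * t) * ht + (J - 2 * w) * hJsq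
    -- One factor 2 serves `hσ`, the other `h2w`; the leading terms match as 3 - 4z - d = 2.
    refine (h2.mul h2).dvd_mul_left.1
      ⟨J * (-8 * e₂ - 2 * e₃ - 4 * z * φ * γ - d * φ ^ 2 - 4 * p * φ * e₂ - p * φ * e₃)
        + (J * e₁ - J * t ^ 2)
          * (2 - 4 * z * p * γ - d * p * φ - 4 * p ^ 2 * e₂ - p ^ 2 * e₃)
        + 2 * σ - 8 * z * J * (-γ * φ + γ ^ 2 * E), ?_⟩
    subst hdz
    linear_combination 2 * hσ + (3 - 4 * (z * (1 + p * γ) + p ^ 2 * e₂)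
      - ((1 - 4 * z) * (1 + p * φ) + p ^ 2 * e₃)) * h2w - 8 * z * J * (1 - p * γ) * hE
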